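/- A consumer faces one product $j$ and a fallback action. The fallback yields $\bar u\in\mathbb R$, ends the search and stays available until the search ends. The purchase value $u_{ij}$ of the product is a real random variable with known distribution $F^u_{ij}$ and finite mean; its realization is revealed only by inspecting the product, at cost $c_{ij}>0$, after which the consumer either purchases the product and receives $u_{ij}$, or takes the fallback. So the available actions are the fallback and inspection before inspection, and the fallback and purchase after it. A policy is optimal if it maximizes the expected payoff from every stage (before inspection, and after inspection for each revealed value). The equation $$c_{ij}=\int_{u>z}(u-z)\,dF^u_{ij}(u)$$ has exactly one solution $z=z_{ij}\in\mathbb R$, the reservation value of the product. Put $w_{ij}:=\min\{z_{ij},u_{ij}\}$, the effective value of the product. A Gittins index policy selects at every stage an available action of highest index, the indices being $\bar u$ for the fallback, $z_{ij}$ for inspection and $u_{ij}$ for purchase. Then, for every $\bar u$: 1. the optimal policies are exactly the Gittins index policies; 2. under every optimal policy and for every realization $u_{ij}$ with $\bar u\ne w_{ij}$, the fallback is selected (whether without or after inspection of the product, which need not be identified) if and only if $\bar u>w_{ij}$; 3. there are optimal policies that resolve ties in favour of the product (the fallback is selected only at stages where $\bar u$ strictly exceeds the index of the other available action), and under each of them,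 for every realization $u_{ij}$ without exception, the fallback is selected if and only if $\bar u>w_{ij}$. -/

import Mathlib

open MeasureTheory

namespace Search

/-- The actions of the problem with one product and a fallback: take the fallback, inspect the
product, or purchase the product at the purchase value `u` revealed by its inspection. -/
inductive Act where
  | fallback : Act
  | inspect : Act
  | purchase (u : ℝ) : Act

/-- The decision stages: the product has not been inspected yet, or it has been inspected and
its purchase value turned out to be `u`. -/
inductive Stage where
  | uninspected : Stage
  | inspected (u : ℝ) : Stage

/-- The actions available at each stage. The fallback is never withdrawn; an inspection replaces
the action of inspecting by the action of purchasing. -/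
def available : Stage → Set Act
  | .uninspected => {Act.fallback, Act.inspect}
  | .inspected u => {Act.fallback, Act.purchase u}

/-- A policy selects an available action at every stage, measurably in the revealed value. -/
structure Policy where
  choice : Stage → Act
  choice_mem : ∀ s, choice s ∈ available s
  measurableSet_purchase : MeasurableSet {u : ℝ | choice (.inspected u) = Act.purchase u}

/-- The action with which the search ends when the realized purchase value is `u`: the first
selected action, unless this is the inspection, in which case it is the action selected next. -/
def Policy.finalAct (π : Policy) (u : ℝ) : Act :=
  match π.choice .uninspected with
  | .inspect => π.choice (.inspected u)
  | a => a

/-- The fallback is selected (with or without a previous inspection of the product) when the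
realized purchase value is `u`. -/
def Policy.SelectsFallback (π : Policy) (u : ℝ) : Prop :=
  π.finalAct u = Act.fallback

/-- Payoff of a policy after an inspection that revealed `u`; `ubar` is the fallback value. -/
def Policy.payoffInspected (ubar : ℝ) (π : Policy) (u : ℝ) : ℝ :=
  match π.choice (.inspected u) with
  | .purchase v => v
  | _ => ubar

/-- Expected payoff of a policy from each stage on; `μ` is the law of the purchase value, `c` the
inspection cost, `ubar` the fallback value. -/
noncomputable def Policy.value (μ : Measure ℝ) (c ubar : ℝ) (π : Policy) : Stage → ℝ
  | .inspected u => π.payoffInspected ubar u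
  | .uninspected =>
    match π.choice .uninspected with
    | .inspect => -c + ∫ u, π.payoffInspected ubar u ∂μ
    | _ => ubar

/-- A policy is optimal if from every stage on its expected payoff is the largest possible. -/
def IsOptimal (μ : Measure ℝ) (c ubar : ℝ) (π : Policy) : Prop :=
  ∀ (s : Stage) (π' : Policy), π'.value μ c ubar s ≤ π.value μ c ubar s

/-- `z` is a reservation value of the product: at the fallback value `z` the inspection cost
equals the expected gain from inspection. -/
def IsReservationValue (μ : Measure ℝ) (c z : ℝ) : Prop :=
  c = ∫ u in Set.Ioi z, (u - z) ∂μ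

/-- The index of an action: the fallback value, the reservation value `z` for inspecting, the
purchase value for purchasing. -/
def gittinsIndex (ubar z : ℝ) : Act → ℝ
  | .fallback => ubar
  | .inspect => z
  | .purchase u => u

/-- The Gittins index policy, with any resolution of ties: an available action of highest index
is selected at every stage. -/
def IsGittins (ubar z : ℝ) (π : Policy) : Prop :=
  ∀ s, ∀ a ∈ available s, gittinsIndex ubar z a ≤ gittinsIndex ubar z (π.choice s)

/-- Ties are resolved in favour of the product: the fallback is selected only at stages where its
index strictly exceeds the index of the other available action. -/
def FavorsProduct (ubar z : ℝ) (π : Policy) : Prop :=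
  ∀ s, π.choice s = Act.fallback →
    ∀ a ∈ available s, a ≠ Act.fallback → gittinsIndex ubar z a < ubar

/-- The effective value of a product with reservation value `z` and purchase value `u`. -/
def effectiveValue (z u : ℝ) : ℝ := min z u

end Search

/-!
The expected gain `x ↦ ∫ max (u - x) 0 ∂μ` from inspecting at the fallback value `x` is Lipschitz,
tends to `0` at `+∞`, takes arbitrarily large values, and is strictly decreasing as long as it is
positive. So it takes the value `c > 0` exactly once, at the reservation value `z`, and inspection
pays off at the fallback value `ubar` exactly if `ubar ≤ z`. By backward induction a policy is
optimal iff it attains the value of the Bellman equation at both stages, and the choices that do so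
are those of highest index.
-/

namespace Search

section ExpectedGain

variable {μ : Measure ℝ} {c x y z : ℝ}

/-- The expected gain from inspection, gross of its cost, when the fallback value is `x`. The
positive part replaces the restriction to `u > x` in `IsReservationValue` so that the domain of
integration does not depend on `x`. -/
noncomputable def expectedGain (μ : Measure ℝ) (x : ℝ) : ℝ := ∫ u, max (u - x) 0 ∂μ

theorem expectedGain_eq_setIntegral (μ : Measure ℝ) (x : ℝ) :
    expectedGain μ x = ∫ u in Set.Ioi x, (u - x) ∂μ := by
  rw [expectedGain, ← integral_indicator measurableSet_Ioi]
  congr 1 with u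
  rcases le_or_gt u x with h | h
  · simp [h]
  · simp [h, h.le]

theorem isReservationValue_iff : IsReservationValue μ c z ↔ expectedGain μ z = c := by
  rw [IsReservationValue, ← expectedGain_eq_setIntegral, eq_comm]

theorem measure_Ioi_ne_zero_of_expectedGain_pos (hx : 0 < expectedGain μ x) :
    μ (Set.Ioi x) ≠ 0 := by
  intro h
  rw [expectedGain_eq_setIntegral, setIntegral_measure_zero _ h] at hx
  exact hx.false

variable [IsFiniteMeasure μ]

theorem integrable_max_sub_zero (hμ : Integrable (fun u : ℝ => u) μ) (x : ℝ) :
    Integrable (fun u : ℝ => max (u - x) 0) μ :=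
  (hμ.sub (integrable_const x)).pos_part

theorem antitone_expectedGain (hμ : Integrable (fun u : ℝ => u) μ) :
    Antitone (expectedGain μ) := fun x y hxy =>
  integral_mono (integrable_max_sub_zero hμ y) (integrable_max_sub_zero hμ x) fun _ => by gcongr

theorem expectedGain_lt_of_lt (hμ : Integrable (fun u : ℝ => u) μ) (hxy : x < y)
    (hy : 0 < expectedGain μ y) : expectedGain μ y < expectedGain μ x := by
  refine (antitone_expectedGain hμ hxy.le).lt_of_ne fun heq => ?_
  have hae : (fun u => max (u - y) 0) =ᵐ[μ] fun u => max (u - x) 0 :=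
    (integral_eq_iff_of_ae_le (integrable_max_sub_zero hμ y) (integrable_max_sub_zero hμ x)
      (.of_forall fun _ => max_le_max_right 0 (by gcongr))).1 heq
  refine measure_Ioi_ne_zero_of_expectedGain_pos hy
    (measure_mono_null (fun u (hu : y < u) => ?_) (ae_iff.1 hae))
  have hyx : max (u - y) 0 < max (u - x) 0 := by
    rw [max_eq_left (sub_nonneg.2 hu.le)]
    exact lt_max_of_lt_left (by gcongr)
  exact hyx.ne

theorem expectedGain_le_expectedGain_iff (hμ : Integrable (fun u : ℝ => u) μ)
    (hy : 0 < expectedGain μ y) : expectedGain μ x ≤ expectedGain μ y ↔ y ≤ x := by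
  refine ⟨fun h => ?_, fun h => antitone_expectedGain hμ h⟩
  by_contra! hxy
  exact (expectedGain_lt_of_lt hμ hxy hy).not_ge h

theorem lipschitzWith_expectedGain (hμ : Integrable (fun u : ℝ => u) μ) :
    LipschitzWith (measureUnivNNReal μ) (expectedGain μ) := by
  refine LipschitzWith.of_dist_le_mul fun x y => ?_
  rw [dist_eq_norm, expectedGain, expectedGain,
    ← integral_sub (integrable_max_sub_zero hμ x) (integrable_max_sub_zero hμ y), mul_comm]
  refine norm_integral_le_of_norm_le_const (.of_forall fun u => ?_)
  calc |max (u - x) 0 - max (u - y) 0| ≤ |(u - x) - (u - y)| := abs_max_sub_max_le_abs ..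
    _ = dist x y := by rw [sub_sub_sub_cancel_left, Real.dist_eq, abs_sub_comm]

theorem tendsto_expectedGain_atTop (hμ : Integrable (fun u : ℝ => u) μ) :
    Filter.Tendsto (expectedGain μ) Filter.atTop (nhds 0) := by
  rw [← integral_zero ℝ ℝ (μ := μ)]
  refine tendsto_integral_filter_of_dominated_convergence (fun u => |u|)
    (.of_forall fun x => (integrable_max_sub_zero hμ x).aestronglyMeasurable) ?_ hμ.abs
    (.of_forall fun u => tendsto_const_nhds.congr' ?_)
  · filter_upwards [Filter.eventually_ge_atTop 0] with x hx
    refine .of_forall fun u => ?_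
    rw [Real.norm_of_nonneg (le_max_right _ _)]
    exact max_le (by linarith [le_abs_self u]) (abs_nonneg u)
  · filter_upwards [Filter.eventually_ge_atTop u] with x hx
    exact (max_eq_right (sub_nonpos.2 hx)).symm

theorem integral_sub_mul_le_expectedGain (hμ : Integrable (fun u : ℝ => u) μ) (x : ℝ) :
    ∫ u, u ∂μ - μ.real Set.univ * x ≤ expectedGain μ x :=
  calc ∫ u, u ∂μ - μ.real Set.univ * x = ∫ u, (u - x) ∂μ := by
        rw [integral_sub hμ (integrable_const x), integral_const, smul_eq_mul]
    _ ≤ expectedGain μ x :=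
        integral_mono (hμ.sub (integrable_const x)) (integrable_max_sub_zero hμ x)
          fun _ => le_max_left _ _

theorem exists_expectedGain_eq [NeZero μ] (hμ : Integrable (fun u : ℝ => u) μ) (hc : 0 < c) :
    ∃ z, expectedGain μ z = c := by
  have hbelow : ∃ b, expectedGain μ b < c :=
    ((tendsto_expectedGain_atTop hμ).eventually_lt_const hc).exists
  have habove : ∃ a, c ≤ expectedGain μ a := by
    refine ⟨(∫ u, u ∂μ - c) / μ.real Set.univ, ?_⟩
    refine le_of_eq_of_le ?_ (integral_sub_mul_le_expectedGain hμ _)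
    rw [mul_div_cancel₀ _ measureReal_univ_ne_zero, sub_sub_cancel]
  exact mem_range_of_exists_le_of_exists_ge (lipschitzWith_expectedGain hμ).continuous
    (hbelow.imp fun _ => le_of_lt) habove

end ExpectedGain

section ReservationValue

variable {μ : Measure ℝ} {c ubar z z' : ℝ}

theorem IsReservationValue.eq [IsFiniteMeasure μ] (hμ : Integrable (fun u : ℝ => u) μ)
    (hc : 0 < c) (hz : IsReservationValue μ c z) (hz' : IsReservationValue μ c z') : z = z' := by
  rw [isReservationValue_iff] at hz hz'
  exact le_antisymm
    ((expectedGain_le_expectedGain_iff hμ (hz ▸ hc)).1 (hz'.trans hz.symm).le)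
    ((expectedGain_le_expectedGain_iff hμ (hz' ▸ hc)).1 (hz.trans hz'.symm).le)

/-- The expected payoff from inspecting and then taking the better of the purchase and the
fallback, net of the inspection cost. -/
noncomputable def inspectionValue (μ : Measure ℝ) (c ubar : ℝ) : ℝ := -c + ∫ u, max ubar u ∂μ

variable [IsProbabilityMeasure μ]

theorem inspectionValue_eq (hμ : Integrable (fun u : ℝ => u) μ) (c ubar : ℝ) :
    inspectionValue μ c ubar = ubar + (expectedGain μ ubar - c) := by
  have hmax (u : ℝ) : max ubar u = ubar + max (u - ubar) 0 := by
    rw [← max_add_add_left, add_sub_cancel, add_zero, max_comm]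
  simp only [inspectionValue, hmax]
  rw [integral_add (integrable_const ubar) (integrable_max_sub_zero hμ ubar), integral_const,
    probReal_univ, one_smul, ← expectedGain]
  ring

theorem IsReservationValue.inspectionValue_le_iff (hμ : Integrable (fun u : ℝ => u) μ)
    (hc : 0 < c) (hz : IsReservationValue μ c z) : inspectionValue μ c ubar ≤ ubar ↔ z ≤ ubar := by
  obtain rfl := isReservationValue_iff.1 hz
  rw [inspectionValue_eq hμ, add_le_iff_nonpos_right, sub_nonpos,
    expectedGain_le_expectedGain_iff hμ hc]

theorem IsReservationValue.le_inspectionValue_iff (hμ : Integrable (fun u : ℝ => u) μ)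
    (hc : 0 < c) (hz : IsReservationValue μ c z) : ubar ≤ inspectionValue μ c ubar ↔ ubar ≤ z := by
  obtain rfl := isReservationValue_iff.1 hz
  rw [inspectionValue_eq hμ, le_add_iff_nonneg_right, sub_nonneg]
  exact ⟨fun h => (expectedGain_le_expectedGain_iff hμ (hc.trans_le h)).1 h,
    fun h => antitone_expectedGain hμ h⟩

end ReservationValue

namespace Policy

variable (π : Policy) (ubar u : ℝ)

theorem choice_uninspected :
    π.choice .uninspected = .fallback ∨ π.choice .uninspected = .inspect :=
  π.choice_mem .uninspected

theorem choice_inspected :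
    π.choice (.inspected u) = .fallback ∨ π.choice (.inspected u) = .purchase u :=
  π.choice_mem (.inspected u)

variable {π ubar u}

theorem selectsFallback_iff : π.SelectsFallback u ↔
    π.choice .uninspected = .fallback ∨ π.choice (.inspected u) = .fallback := by
  rcases π.choice_uninspected with h | h <;> simp [SelectsFallback, finalAct, h]

theorem payoffInspected_of_fallback (h : π.choice (.inspected u) = .fallback) :
    π.payoffInspected ubar u = ubar := by simp only [payoffInspected, h]

theorem payoffInspected_of_purchase (h : π.choice (.inspected u) = .purchase u) :
    π.payoffInspected ubar u = u := by simp only [payoffInspected, h]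

theorem payoffInspected_eq_max_iff : π.payoffInspected ubar u = max ubar u ↔
    (π.choice (.inspected u) = .fallback → u ≤ ubar) ∧
      (π.choice (.inspected u) = .purchase u → ubar ≤ u) := by
  rcases π.choice_inspected u with h | h
  · simp [payoffInspected_of_fallback h, h]
  · simp [payoffInspected_of_purchase h, h]

theorem payoffInspected_le_max (π : Policy) (ubar u : ℝ) :
    π.payoffInspected ubar u ≤ max ubar u := by
  rcases π.choice_inspected u with h | h
  · exact (payoffInspected_of_fallback h).trans_le (le_max_left _ _)
  · exact (payoffInspected_of_purchase h).trans_le (le_max_right _ _)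

variable {μ : Measure ℝ} {c : ℝ}

theorem integrable_payoffInspected [IsFiniteMeasure μ] (hμ : Integrable (fun u : ℝ => u) μ)
    (π : Policy) (ubar : ℝ) : Integrable (π.payoffInspected ubar) μ := by
  classical
  have hpiecewise : π.payoffInspected ubar =
      {u | π.choice (.inspected u) = .purchase u}.piecewise (fun u => u) fun _ => ubar := by
    funext u
    rcases π.choice_inspected u with h | h
    · simp [payoffInspected_of_fallback h, h]
    · simp [payoffInspected_of_purchase h, h]
  rw [hpiecewise]
  exact .piecewise π.measurableSet_purchase hμ.integrableOn (integrable_const ubar).integrableOn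

theorem integral_payoffInspected_le [IsFiniteMeasure μ] (hμ : Integrable (fun u : ℝ => u) μ)
    (π : Policy) (ubar : ℝ) : ∫ u, π.payoffInspected ubar u ∂μ ≤ ∫ u, max ubar u ∂μ :=
  integral_mono (π.integrable_payoffInspected hμ ubar) ((integrable_const ubar).sup hμ)
    (π.payoffInspected_le_max ubar)

theorem value_uninspected_of_fallback (h : π.choice .uninspected = .fallback) :
    π.value μ c ubar .uninspected = ubar := by simp only [value, h]

theorem value_uninspected_of_inspect (h : π.choice .uninspected = .inspect) :
    π.value μ c ubar .uninspected = -c + ∫ u, π.payoffInspected ubar u ∂μ := by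
  simp only [value, h]

end Policy

section Optimality

variable {μ : Measure ℝ} {c ubar z u : ℝ} {π : Policy}

/-- The value function of the search problem, given by the Bellman equation: at each stage the
better of the two available actions, followed by optimal behaviour. -/
noncomputable def bellmanValue (μ : Measure ℝ) (c ubar : ℝ) : Stage → ℝ
  | .uninspected => max ubar (inspectionValue μ c ubar)
  | .inspected u => max ubar u

theorem Policy.value_le_bellmanValue [IsFiniteMeasure μ] (hμ : Integrable (fun u : ℝ => u) μ)
    (π : Policy) (c ubar : ℝ) (s : Stage) : π.value μ c ubar s ≤ bellmanValue μ c ubar s := by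
  rcases s with _ | u
  · rcases π.choice_uninspected with h | h
    · exact (value_uninspected_of_fallback h).trans_le (le_max_left _ _)
    · rw [value_uninspected_of_inspect h]
      exact le_max_of_le_right (add_le_add_right (π.integral_payoffInspected_le hμ ubar) (-c))
  · exact π.payoffInspected_le_max ubar u

theorem isGittins_iff : IsGittins ubar z π ↔
    ((π.choice .uninspected = .fallback → z ≤ ubar) ∧
      (π.choice .uninspected = .inspect → ubar ≤ z)) ∧
    ∀ u, (π.choice (.inspected u) = .fallback → u ≤ ubar) ∧
      (π.choice (.inspected u) = .purchase u → ubar ≤ u) := by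
  have huninspected : (∀ a ∈ available .uninspected,
      gittinsIndex ubar z a ≤ gittinsIndex ubar z (π.choice .uninspected)) ↔
      (π.choice .uninspected = .fallback → z ≤ ubar) ∧
      (π.choice .uninspected = .inspect → ubar ≤ z) := by
    rcases π.choice_uninspected with h | h <;> simp [h, available, gittinsIndex]
  have hinspected (u : ℝ) : (∀ a ∈ available (.inspected u),
      gittinsIndex ubar z a ≤ gittinsIndex ubar z (π.choice (.inspected u))) ↔
      (π.choice (.inspected u) = .fallback → u ≤ ubar) ∧
      (π.choice (.inspected u) = .purchase u → ubar ≤ u) := by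
    rcases π.choice_inspected u with h | h <;> simp [h, available, gittinsIndex]
  simp only [← huninspected, ← hinspected]
  exact ⟨fun h => ⟨h _, fun u => h _⟩, fun h s => by cases s; exacts [h.1, h.2 _]⟩

theorem favorsProduct_iff : FavorsProduct ubar z π ↔
    (π.choice .uninspected = .fallback → z < ubar) ∧
      ∀ u, π.choice (.inspected u) = .fallback → u < ubar := by
  refine ⟨fun h => ⟨fun hf => h _ hf .inspect (.inr rfl) nofun,
    fun u hf => h _ hf (.purchase u) (.inr rfl) nofun⟩, ?_⟩
  rintro ⟨huninspected, hinspected⟩ (_ | u) hf a (rfl | rfl) ha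
  exacts [absurd rfl ha, huninspected hf, absurd rfl ha, hinspected u hf]

theorem forall_value_eq_bellmanValue_iff [IsProbabilityMeasure μ]
    (hμ : Integrable (fun u : ℝ => u) μ) (hc : 0 < c) (hz : IsReservationValue μ c z) :
    (∀ s, π.value μ c ubar s = bellmanValue μ c ubar s) ↔ IsGittins ubar z π := by
  have hstages : (∀ s, π.value μ c ubar s = bellmanValue μ c ubar s) ↔
      π.value μ c ubar .uninspected = max ubar (inspectionValue μ c ubar) ∧
        ∀ u, π.payoffInspected ubar u = max ubar u :=
    ⟨fun h => ⟨h _, fun u => h (.inspected u)⟩, fun h s => by cases s; exacts [h.1, h.2 _]⟩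
  simp only [hstages, isGittins_iff, ← Policy.payoffInspected_eq_max_iff]
  refine and_congr_left fun hmax => ?_
  rcases π.choice_uninspected with h | h
  · simp [Policy.value_uninspected_of_fallback h, h, hz.inspectionValue_le_iff hμ hc]
  · have hvalue : π.value μ c ubar .uninspected = inspectionValue μ c ubar := by
      simp only [Policy.value_uninspected_of_inspect h, hmax, inspectionValue]
    simp [hvalue, h, hz.le_inspectionValue_iff hμ hc]

/-- The Gittins index policy that resolves ties in favour of the product. -/
noncomputable def favoringPolicy (ubar z : ℝ) : Policy where
  choice
    | .uninspected => if z < ubar then .fallback else .inspect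
    | .inspected u => if u < ubar then .fallback else .purchase u
  choice_mem
    | .uninspected => by by_cases h : z < ubar <;> simp [h, available]
    | .inspected u => by by_cases h : u < ubar <;> simp [h, available]
  measurableSet_purchase := by
    convert measurableSet_Ici (a := ubar) using 1
    ext u
    simp

theorem isGittins_favoringPolicy (ubar z : ℝ) : IsGittins ubar z (favoringPolicy ubar z) := by
  simpa [isGittins_iff, favoringPolicy] using ⟨le_of_lt, fun u => le_of_lt⟩

theorem favorsProduct_favoringPolicy (ubar z : ℝ) :
    FavorsProduct ubar z (favoringPolicy ubar z) := by
  simp [favorsProduct_iff, favoringPolicy]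

theorem isOptimal_iff_isGittins [IsProbabilityMeasure μ] (hμ : Integrable (fun u : ℝ => u) μ)
    (hc : 0 < c) (hz : IsReservationValue μ c z) : IsOptimal μ c ubar π ↔ IsGittins ubar z π := by
  have hattained {π : Policy} := forall_value_eq_bellmanValue_iff (π := π) (ubar := ubar) hμ hc hz
  refine ⟨fun hopt => hattained.1 fun s => (π.value_le_bellmanValue hμ c ubar s).antisymm ?_,
    fun hg s π' => (π'.value_le_bellmanValue hμ c ubar s).trans_eq (hattained.2 hg s).symm⟩
  exact (hattained.2 (isGittins_favoringPolicy ubar z) s).symm.trans_le (hopt s _)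

end Optimality

section EffectiveValue

variable {ubar z u : ℝ} {π : Policy}

theorem IsGittins.selectsFallback_of_effectiveValue_lt (h : IsGittins ubar z π)
    (hlt : effectiveValue z u < ubar) : π.SelectsFallback u := by
  obtain ⟨⟨-, hinspect⟩, hinspected⟩ := isGittins_iff.1 h
  refine Policy.selectsFallback_iff.2 ((min_lt_iff.1 hlt).imp (fun hz => ?_) fun hu => ?_)
  · exact π.choice_uninspected.resolve_right fun hi => (hinspect hi).not_gt hz
  · exact (π.choice_inspected u).resolve_right fun hp => ((hinspected u).2 hp).not_gt hu

theorem IsGittins.effectiveValue_le (h : IsGittins ubar z π) (hsel : π.SelectsFallback u) :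
    effectiveValue z u ≤ ubar := by
  obtain ⟨⟨hfallback, -⟩, hinspected⟩ := isGittins_iff.1 h
  exact min_le_iff.2 ((Policy.selectsFallback_iff.1 hsel).imp hfallback (hinspected u).1)

theorem FavorsProduct.effectiveValue_lt (h : FavorsProduct ubar z π) (hsel : π.SelectsFallback u) :
    effectiveValue z u < ubar := by
  obtain ⟨huninspected, hinspected⟩ := favorsProduct_iff.1 h
  exact min_lt_iff.2 ((Policy.selectsFallback_iff.1 hsel).imp huninspected (hinspected u))

theorem IsGittins.selectsFallback_iff_of_ne (h : IsGittins ubar z π)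
    (hne : ubar ≠ effectiveValue z u) : π.SelectsFallback u ↔ ubar > effectiveValue z u :=
  ⟨fun hsel => (h.effectiveValue_le hsel).lt_of_ne' hne, h.selectsFallback_of_effectiveValue_lt⟩

theorem IsGittins.selectsFallback_iff_of_favorsProduct (h : IsGittins ubar z π)
    (hfav : FavorsProduct ubar z π) (u : ℝ) : π.SelectsFallback u ↔ ubar > effectiveValue z u :=
  ⟨hfav.effectiveValue_lt, h.selectsFallback_of_effectiveValue_lt⟩

end EffectiveValue

end Search

theorem lemma2 (μ : Measure ℝ) [IsProbabilityMeasure μ] (hμ : Integrable (fun u : ℝ => u) μ)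
    (c : ℝ) (hc : 0 < c) :
    ∃ z : ℝ, Search.IsReservationValue μ c z ∧
      (∀ z' : ℝ, Search.IsReservationValue μ c z' → z' = z) ∧
      ∀ ubar : ℝ,
        -- the optimal policies are exactly the Gittins index policies
        (∀ π : Search.Policy, Search.IsOptimal μ c ubar π ↔ Search.IsGittins ubar z π) ∧
        -- under any of them, the fallback is selected iff it exceeds the effective value,
        -- ties being left open
        (∀ π : Search.Policy, Search.IsOptimal μ c ubar π →
          ∀ u : ℝ, ubar ≠ Search.effectiveValue z u →
            (π.SelectsFallback u ↔ ubar > Search.effectiveValue z u)) ∧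
        -- and without exception if ties are resolved in favour of the product
        (∃ π : Search.Policy, Search.IsOptimal μ c ubar π ∧ Search.FavorsProduct ubar z π) ∧
        (∀ π : Search.Policy, Search.IsOptimal μ c ubar π → Search.FavorsProduct ubar z π →
          ∀ u : ℝ, π.SelectsFallback u ↔ ubar > Search.effectiveValue z u) := by
  obtain ⟨z, hgain⟩ := Search.exists_expectedGain_eq hμ hc
  have hz : Search.IsReservationValue μ c z := Search.isReservationValue_iff.2 hgain
  refine ⟨z, hz, fun z' hz' => hz'.eq hμ hc hz, fun ubar => ?_⟩
  have hopt (π : Search.Policy) : Search.IsOptimal μ c ubar π ↔ Search.IsGittins ubar z π :=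
    Search.isOptimal_iff_isGittins hμ hc hz
  refine ⟨hopt, ?_⟩
  simp only [hopt]
  exact ⟨fun π hπ u hne => hπ.selectsFallback_iff_of_ne hne,
    ⟨Search.favoringPolicy ubar z, Search.isGittins_favoringPolicy ubar z,
      Search.favorsProduct_favoringPolicy ubar z⟩,
    fun π hπ hfav => hπ.selectsFallback_iff_of_favorsProduct hfav⟩
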